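/- Let $G$ be a group with a left-order $\le$, that is, a linear order such that $a\le b$ implies $ca\le cb$ for all $a,b,c\in G$. A pair $(C',C)$ of convex subgroups of $G$ is a convex jump if $C'\subsetneq C$ and no convex subgroup lies strictly between $C'$ and $C$. The left-order $\le$ is called Conradian if for every convex jump $(C',C)$ the subgroup $C'$ is normal in $C$ and $C/C'$ is archimedean with respect to its canonical order, whose positive cone is $\{aC' \mid a\in C,\ e\le a\}$; here an ordered group is archimedean if for all $a,b$ with $e<b$ there is $n\in\mathbb N$ with $a<b^n$. Let $F$ be a skew field. A crossed product $F[G,\eta,\alpha]$ of $G$ over $F$ is a ring $S$ that is a free left $F$-module (with the same addition) with a basis $(x_g)_{g\in G}$, together with maps $\eta:G\times G\to F^\times$ and $\alpha:G\to\operatorname{Aut}F$, $g\mapsto\alpha_g$, such that $1x_e$ is the unit element of $S$, $ax_e\cdot bx_e=abx_e$, $ax_e\cdot x_g=ax_g$, $x_g\cdot x_h=\eta(g,h)x_{gh}$ and $x_g\cdot ax_e=\alpha_g(a)x_g$ for all $a,b\in F$ and $g,h\in G$. Proposition. If $G$ possesses a Conradian left-order $\le$ such that the set of convex subgroups of $G$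 with respect to $\le$ is well-ordered by inclusion, then every crossed product $R=F[G,\eta,\alpha]$ of $G$ over a skew field $F$ is a (left and right) Ore domain, that is, $R\neq 0$ has no zero-divisors, and $Ra\cap Rb\neq 0$ and $aR\cap bR\neq 0$ for all non-zero $a,b\in R$. -/

import Mathlib

namespace ConradOre

/-- The set of convex subgroups of an ordered group; as a subtype of `Subgroup G` it is ordered by
inclusion. -/
abbrev ConvexSubgroup (G : Type*) [Group G] [LinearOrder G] : Type _ :=
  {C : Subgroup G // (C : Set G).OrdConnected}

/-- The canonical order of the factor group `H ⧸ N`: its positive cone is the image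
`{aN | 1 ≤ a}` of the positive cone of `H`, and `x ≤ y` means that `x⁻¹ y` lies in this cone. -/
def canonicalLE {H : Type*} [Group H] [LE H] (N : Subgroup H) [N.Normal] (x y : H ⧸ N) : Prop :=
  x⁻¹ * y ∈ (fun a : H => (a : H ⧸ N)) '' {a : H | 1 ≤ a}

/-- A left-order `le` of a group is archimedean if for all `a` and all `b > 1` there is a natural
number `n` with `a < b ^ n`; the strict relation `x < y` is `le x y ∧ x ≠ y`. -/
def IsArchimedeanOrder {H : Type*} [Group H] (le : H → H → Prop) : Prop :=
  ∀ a b : H, (le 1 b ∧ 1 ≠ b) → ∃ n : ℕ, le a (b ^ n) ∧ a ≠ b ^ n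

/-- The order of `G` is Conradian: for each convex jump `(C', C)` (i.e. `C' ⋖ C` among the convex
subgroups), `C'` is normal in `C` and `C / C'` is archimedean for its canonical order. -/
def IsConradian (G : Type*) [Group G] [LinearOrder G] : Prop :=
  ∀ C' C : ConvexSubgroup G, C' ⋖ C →
    ∃ _ : (C'.1.subgroupOf C.1).Normal,
      IsArchimedeanOrder (canonicalLE (C'.1.subgroupOf C.1))

/-- `S` is a crossed product of the group `G` over the ring `R`: the ring `S` is a free left
`R`-module with basis `x_g` (`g ∈ G`), with maps `η : G × G → Rˣ` and `α : G → Aut R` that satisfy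
the five rules below. The ring `R` is contained in `S` through `a ↦ a x_e`. -/
structure CrossedProduct (R G S : Type*) [Ring R] [Group G] [Ring S] [Module R S] where
  /-- the basis `X_G` -/
  x : Module.Basis G R S
  /-- the twisting -/
  η : G → G → Rˣ
  /-- the action -/
  α : G → (R ≃+* R)
  one_smul_x_one : (1 : R) • x 1 = 1
  coeff_mul_coeff (a b : R) : (a • x 1) * (b • x 1) = (a * b) • x 1
  coeff_mul_x (a : R) (g : G) : (a • x 1) * ((1 : R) • x g) = a • x g
  x_mul_x (g h : G) : ((1 : R) • x g) * ((1 : R) • x h) = (η g h : R) • x (g * h)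
  x_mul_coeff (g : G) (a : R) : ((1 : R) • x g) * (a • x 1) = α g a • x g

/-- A (left and right) Ore domain: an integral domain, not necessarily commutative, in which
`Ra ∩ Rb ≠ 0` and `aR ∩ bR ≠ 0` for all non-zero `a`, `b`. -/
structure IsOreDomain (R : Type*) [Ring R] : Prop where
  isDomain : IsDomain R
  left_ore : ∀ a b : R, a ≠ 0 → b ≠ 0 → ∃ c d : R, c * a = d * b ∧ c * a ≠ 0
  right_ore : ∀ a b : R, a ≠ 0 → b ≠ 0 → ∃ c d : R, a * c = b * d ∧ a * c ≠ 0

end ConradOre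

namespace ConradOre

/-! For a subgroup `H` let `S_H` be the subring of elements supported in `H`. The left Ore condition
for `S_C` follows by well-founded induction over the convex subgroups `C`. If `C` is trivial,
nonzero elements of `S_C` are units. If `C` is the directed union of smaller convex subgroups, two
elements already lie in one smaller subring. Otherwise `C` covers some `C'`, and `C / C'` is
archimedean, hence abelian by Hölder (`commute_of_archimedean`).

The last case is a growth argument (`leftOreOn_of_comm_quotient`). `S_C` is free over `S_{C'}` on
homogeneous units `e_q`, `q ∈ C / C'`. Let `T` be the image of the supports of `a` and `b`.
Polynomial growth of abelian groups gives a finite `U` with `|UT| < 2|U|`. The `2|U|` elements `e_u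
a`, `e_u b` lie in the span of `|UT|` basis elements, so they are dependent over the left Ore domain
`S_{C'}`; the relation reads `c a = d b`.

Only the left-right symmetric structure `GradedDivision` is used, so the right condition is the left
one for the opposite ring. -/

theorem exists_pow_le_lt_pow_succ {Q : Type*} [Group Q] [LinearOrder Q]
    (harch : ∀ a b : Q, 1 < b → ∃ n : ℕ, a < b ^ n) {d a : Q} (hd : 1 < d) (ha : 1 ≤ a) :
    ∃ n : ℕ, d ^ n ≤ a ∧ a < d ^ (n + 1) := by
  classical
  have hex := harch a d hd
  have hspec := Nat.find_spec hex
  obtain ⟨n, hn⟩ : ∃ n, Nat.find hex = n + 1 := by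
    refine Nat.exists_eq_succ_of_ne_zero fun h0 => ?_
    rw [h0, pow_zero] at hspec
    exact absurd ha hspec.not_ge
  refine ⟨n, ?_, hn ▸ hspec⟩
  exact not_lt.1 (Nat.find_min hex (by omega))

/-! ### Archimedean left-ordered groups are commutative -/

section Hoelder

variable {Q : Type*} [Group Q] [LinearOrder Q] [MulLeftMono Q]

/-- If `g > 1` and `p g ≤ g`, then `p ^ n < p ^ n * g ≤ g` for all `n`, against the archimedean
property. The case `g < 1` follows by inverting both `g` and the conjugate. -/
theorem one_lt_conj_of_archimedean (harch : ∀ a b : Q, 1 < b → ∃ n : ℕ, a < b ^ n) {p : Q}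
    (hp : 1 < p) (g : Q) : 1 < g⁻¹ * p * g := by
  have key : ∀ (p g : Q), 1 < p → 1 < g → 1 < g⁻¹ * p * g := by
    intro p g hp hg
    by_contra! h
    have h1 : p * g ≤ g := by
      have := mul_le_mul_right h g
      simpa [mul_assoc] using this
    have h2 : ∀ n : ℕ, p ^ n * g ≤ g := by
      intro n
      induction n with
      | zero => simp
      | succ n ih =>
        calc p ^ (n + 1) * g = p ^ n * (p * g) := by rw [pow_succ, mul_assoc]
          _ ≤ p ^ n * g := mul_le_mul_right h1 _
          _ ≤ g := ih
    obtain ⟨n, hn⟩ := harch g p hp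
    have h3 : p ^ n < p ^ n * g := lt_mul_of_one_lt_right' _ hg
    exact absurd (h3.trans_le (h2 n)) hn.not_gt
  rcases lt_trichotomy 1 g with hg | hg | hg
  · exact key p g hp hg
  · simpa [← hg] using hp
  · by_contra! h
    have hne : g⁻¹ * p * g ≠ 1 := by
      intro h1
      have h2 : p = g * (g⁻¹ * p * g) * g⁻¹ := by group
      rw [h1] at h2
      simp at h2
      exact hp.ne' h2
    have hlt : g⁻¹ * p * g < 1 := lt_of_le_of_ne h hne
    have h1 := key (g⁻¹ * p * g)⁻¹ g⁻¹ (Left.one_lt_inv_iff.2 hlt) (Left.one_lt_inv_iff.2 hg)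
    have h2 : g⁻¹⁻¹ * (g⁻¹ * p * g)⁻¹ * g⁻¹ = p⁻¹ := by group
    rw [h2, Left.one_lt_inv_iff] at h1
    exact absurd hp h1.not_gt

theorem mulRightMono_of_archimedean (harch : ∀ a b : Q, 1 < b → ∃ n : ℕ, a < b ^ n) :
    MulRightMono Q := by
  refine ⟨fun c a b hab => ?_⟩
  rcases hab.eq_or_lt with rfl | hlt
  · exact le_rfl
  have h1 : 1 < a⁻¹ * b := by
    have := mul_lt_mul_right hlt a⁻¹
    simpa using this
  have h2 := mul_le_mul_right (one_lt_conj_of_archimedean harch h1 c).le (a * c)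
  change a * c ≤ b * c
  calc a * c = a * c * 1 := by simp
    _ ≤ a * c * (c⁻¹ * (a⁻¹ * b) * c) := h2
    _ = b * c := by group

/-- **Hölder's theorem** for left-orders: an archimedean left-ordered group is commutative. -/
theorem commute_of_archimedean (harch : ∀ a b : Q, 1 < b → ∃ n : ℕ, a < b ^ n) (a b : Q) :
    Commute a b := by
  have := mulRightMono_of_archimedean harch
  have key : ∀ a b : Q, 1 < a → 1 < b → Commute a b := by
    by_cases hmin : ∃ e : Q, 1 < e ∧ ∀ p : Q, 1 < p → e ≤ p
    · obtain ⟨e, he, hle⟩ := hmin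
      have hpow : ∀ a : Q, 1 < a → ∃ n : ℕ, a = e ^ n := by
        intro a ha
        obtain ⟨n, h1, h2⟩ := exists_pow_le_lt_pow_succ harch he ha.le
        refine ⟨n, (h1.eq_or_lt.resolve_right fun h3 => ?_).symm⟩
        have h4 : 1 < (e ^ n)⁻¹ * a := by
          have := mul_lt_mul_right h3 (e ^ n)⁻¹
          simpa using this
        have h5 := mul_le_mul_right (hle _ h4) (e ^ n)
        rw [mul_inv_cancel_left, ← pow_succ] at h5
        exact absurd h2 h5.not_gt
      intro a b ha hb
      obtain ⟨n, rfl⟩ := hpow a ha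
      obtain ⟨m, rfl⟩ := hpow b hb
      exact Commute.pow_pow (Commute.refl e) n m
    · push Not at hmin
      -- Without a least positive element, one of `p` and `p⁻¹ ε` with `1 < p < ε` has square at
      -- most `ε`.
      have hsq : ∀ ε : Q, 1 < ε → ∃ d : Q, 1 < d ∧ d * d ≤ ε := by
        intro ε hε
        obtain ⟨p, hp, hpε⟩ := hmin ε hε
        by_cases h : p * p ≤ ε
        · exact ⟨p, hp, h⟩
        push Not at h
        refine ⟨p⁻¹ * ε, ?_, ?_⟩
        · have := mul_lt_mul_right hpε p⁻¹
          simpa using this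
        · have h1 : p⁻¹ * ε ≤ p := by
            have := mul_le_mul_right h.le p⁻¹
            simpa using this
          calc p⁻¹ * ε * (p⁻¹ * ε) ≤ p * (p⁻¹ * ε) := mul_le_mul_left h1 _
            _ = ε := by group
      have hcomm : ∀ a b : Q, 1 < a → 1 < b → a * b ≤ b * a := by
        intro a b ha hb
        by_contra! hlt
        have hε : 1 < (b * a)⁻¹ * (a * b) := by
          have := mul_lt_mul_right hlt (b * a)⁻¹
          simpa using this
        -- Squeezing `a` and `b` between consecutive powers of `d` bounds the commutator strictly
        -- below `d ^ 2`.
        obtain ⟨d, hd, hdd⟩ := hsq _ hε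
        obtain ⟨n, hn1, hn2⟩ := exists_pow_le_lt_pow_succ harch hd ha.le
        obtain ⟨m, hm1, hm2⟩ := exists_pow_le_lt_pow_succ harch hd hb.le
        have h1 : a * b < d ^ (n + 1) * d ^ (m + 1) := Right.mul_lt_mul hn2 hm2
        have h2 : d ^ (n + 1) * d ^ (m + 1) = d ^ m * d ^ n * (d * d) := by
          rw [← pow_two, ← pow_add, ← pow_add, ← pow_add]
          congr 1
          omega
        have h3 : d ^ m * d ^ n * (d * d) ≤ b * a * ((b * a)⁻¹ * (a * b)) :=
          mul_le_mul' (mul_le_mul' hm1 hn1) hdd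
        rw [mul_inv_cancel_left, ← h2] at h3
        exact absurd h1 h3.not_gt
      intro a b ha hb
      exact le_antisymm (hcomm a b ha hb) (hcomm b a hb ha)
  have key' : ∀ a b : Q, 1 < a → Commute a b := by
    intro a b ha
    rcases lt_trichotomy 1 b with hb | hb | hb
    · exact key a b ha hb
    · exact hb ▸ Commute.one_right a
    · exact Commute.inv_right_iff.1 (key a b⁻¹ ha (Left.one_lt_inv_iff.2 hb))
  rcases lt_trichotomy 1 a with ha | ha | ha
  · exact key' a b ha
  · exact ha ▸ Commute.one_left b
  · exact Commute.inv_left_iff.1 (key' a⁻¹ b (Left.one_lt_inv_iff.2 ha))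

end Hoelder

/-! ### The canonical order on a convex quotient -/

section Quotient

variable {H : Type*} [Group H] [LinearOrder H] [MulLeftMono H]

/-- The canonical order of the factor group by a convex normal subgroup is linear. -/
noncomputable abbrev quotientLinearOrder (N : Subgroup H) [N.Normal]
    (hN : (N : Set H).OrdConnected) : LinearOrder (H ⧸ N) where
  le := canonicalLE N
  le_refl x := ⟨1, le_refl (1 : H), by simp⟩
  le_trans x y z := by
    rintro ⟨a, ha, hxy⟩ ⟨b, hb, hyz⟩
    refine ⟨a * b, one_le_mul ha hb, ?_⟩
    change (a : H ⧸ N) = x⁻¹ * y at hxy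
    change (b : H ⧸ N) = y⁻¹ * z at hyz
    change ((a * b : H) : H ⧸ N) = x⁻¹ * z
    rw [QuotientGroup.mk_mul, hxy, hyz]
    group
  le_antisymm x y := by
    rintro ⟨a, ha, hxy⟩ ⟨b, hb, hyx⟩
    change (a : H ⧸ N) = x⁻¹ * y at hxy
    change (b : H ⧸ N) = y⁻¹ * x at hyx
    have h1 : ((a * b : H) : H ⧸ N) = 1 := by
      rw [QuotientGroup.mk_mul, hxy, hyx]
      group
    have h2 : a * b ∈ N := (QuotientGroup.eq_one_iff _).1 h1
    -- Convexity of `N` enters here, through `1 ≤ a ≤ a * b`.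
    have h3 : a ∈ N := hN.out N.one_mem h2 ⟨ha, le_mul_of_one_le_right' hb⟩
    rw [(QuotientGroup.eq_one_iff a).2 h3] at hxy
    exact (inv_mul_eq_one.1 hxy.symm)
  le_total x y := by
    obtain ⟨a, ha⟩ := QuotientGroup.mk_surjective (x⁻¹ * y)
    rcases le_total 1 a with h | h
    · exact Or.inl ⟨a, h, ha⟩
    · refine Or.inr ⟨a⁻¹, Left.one_le_inv_iff.2 h, ?_⟩
      change ((a⁻¹ : H) : H ⧸ N) = y⁻¹ * x
      rw [QuotientGroup.mk_inv, ha]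
      group
  toDecidableLE := Classical.decRel _

theorem quotient_commute_of_isArchimedeanOrder (N : Subgroup H) [N.Normal]
    (hN : (N : Set H).OrdConnected) (h : IsArchimedeanOrder (canonicalLE N)) (a b : H ⧸ N) :
    Commute a b := by
  let := quotientLinearOrder N hN
  have : MulLeftMono (H ⧸ N) := by
    refine ⟨fun c x y hxy => ?_⟩
    change canonicalLE N (c * x) (c * y)
    change canonicalLE N x y at hxy
    unfold canonicalLE at hxy ⊢
    have h1 : (c * x)⁻¹ * (c * y) = x⁻¹ * y := by group
    rw [h1]
    exact hxy
  refine commute_of_archimedean (fun x y hy => ?_) a b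
  obtain ⟨n, h1, h2⟩ := h x y ⟨hy.le, hy.ne⟩
  exact ⟨n, lt_of_le_of_ne h1 h2⟩

end Quotient

/-! ### Growth in abelian groups and linear algebra over Ore domains -/

open scoped Pointwise in
/-- In a commutative group every finite set has small growth. -/
theorem exists_card_mul_lt_two_mul_card {Q : Type*} [CommGroup Q] [DecidableEq Q] (T : Finset Q) :
    ∃ U : Finset Q, (U * T).card < 2 * U.card := by
  by_contra! hcon
  -- Exponents are below `n`, so `U 0` is empty for nonempty `T` and the doubling has to start at `U
  -- 1`. Doubling would force `2 ^ n ≤ (n + 1) ^ |T|` for all `n`.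
  let U : ℕ → Finset Q := fun n =>
    (Fintype.piFinset (fun _ : T => Finset.range n)).image (fun f => ∏ t : T, (t : Q) ^ (f t))
  have hcard : ∀ n, (U n).card ≤ n ^ T.card := by
    intro n
    refine Finset.card_image_le.trans ?_
    simp
  have hsub : ∀ n, U n * T ⊆ U (n + 1) := by
    intro n x hx
    obtain ⟨u, hu, t, ht, rfl⟩ := Finset.mem_mul.1 hx
    obtain ⟨f, hf, rfl⟩ := Finset.mem_image.1 hu
    refine Finset.mem_image.2 ⟨f + Pi.single ⟨t, ht⟩ 1, ?_, ?_⟩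
    · rw [Fintype.mem_piFinset] at hf ⊢
      intro s
      have h1 := Finset.mem_range.1 (hf s)
      rw [Finset.mem_range, Pi.add_apply]
      have h2 : (Pi.single (⟨t, ht⟩ : T) 1 : T → ℕ) s ≤ 1 := by
        rw [Pi.single_apply]
        split_ifs <;> simp
      omega
    · simp only [Pi.add_apply, pow_add, Finset.prod_mul_distrib]
      congr 1
      rw [Finset.prod_eq_single (⟨t, ht⟩ : T)]
      · simp
      · intro s _ hs
        simp [hs]
      · simp
  have hpow : ∀ n, 2 ^ n ≤ (U (n + 1)).card := by
    intro n
    induction n with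
    | zero =>
      have : (U 1).Nonempty := by
        refine Finset.Nonempty.image ⟨fun _ => 0, ?_⟩ _
        simp
      simpa using this.card_pos
    | succ n ih =>
      calc 2 ^ (n + 1) = 2 * 2 ^ n := by ring
        _ ≤ 2 * (U (n + 1)).card := by omega
        _ ≤ (U (n + 1) * T).card := hcon _
        _ ≤ _ := Finset.card_le_card (hsub _)
  have hlim := tendsto_pow_const_div_const_pow_of_one_lt T.card (one_lt_two : (1 : ℝ) < 2)
  obtain ⟨n, hn1, hn2⟩ := ((hlim.eventually_lt_const (by norm_num : (0 : ℝ) < 1 / 2)).and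
    (Filter.eventually_ge_atTop 1)).exists
  obtain ⟨m, rfl⟩ : ∃ m, n = m + 1 := ⟨n - 1, by omega⟩
  have h1 : (2 : ℝ) ^ m ≤ ((m + 1 : ℕ) : ℝ) ^ T.card := by
    exact_mod_cast (hpow m).trans (hcard _)
  rw [div_lt_iff₀ (by positivity), pow_succ] at hn1
  linarith

/-- Over a left Ore domain, `n` homogeneous linear equations in `n + 1` unknowns have a nonzero
solution. -/
theorem exists_ne_zero_sum_mul_eq_zero {R : Type*} [Ring R] [NoZeroDivisors R] [Nontrivial R]
    (hR : ∀ a b : R, a ≠ 0 → b ≠ 0 → ∃ c d : R, c * a = d * b ∧ c * a ≠ 0) (n : ℕ)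
    (v : Fin (n + 1) → Fin n → R) :
    ∃ r : Fin (n + 1) → R, r ≠ 0 ∧ ∀ k, ∑ i, r i * v i k = 0 := by
  induction n with
  | zero => exact ⟨1, one_ne_zero, fun k => k.elim0⟩
  | succ n ih =>
    by_cases h0 : ∀ i, v i (Fin.last n) = 0
    · obtain ⟨r, hr, hrv⟩ := ih fun i k => v i.castSucc k.castSucc
      refine ⟨Fin.snoc r 0, fun h => hr ?_, fun k => ?_⟩
      · funext i
        have := congrFun h i.castSucc
        simpa using this
      · induction k using Fin.lastCases with
        | last => simp [h0]
        | cast k => simpa [Fin.sum_univ_castSucc] using hrv k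
    · push Not at h0
      obtain ⟨j, hj⟩ := h0
      -- Gaussian elimination with pivot row `j`: the Ore condition supplies left multipliers that
      -- clear the last column.
      have hex : ∀ i, ∃ c d : R, c ≠ 0 ∧ c * v i (Fin.last n) = d * v j (Fin.last n) := by
        intro i
        by_cases hi : v i (Fin.last n) = 0
        · exact ⟨1, 0, one_ne_zero, by simp [hi]⟩
        · obtain ⟨c, d, h1, h2⟩ := hR _ _ hi hj
          exact ⟨c, d, left_ne_zero_of_mul h2, h1⟩
      choose c d hc hcd using hex
      obtain ⟨r, hr, hrv⟩ := ih fun i k =>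
        c (j.succAbove i) * v (j.succAbove i) k.castSucc - d (j.succAbove i) * v j k.castSucc
      have hall : ∀ k, ∑ i, r i * (c (j.succAbove i) * v (j.succAbove i) k
          - d (j.succAbove i) * v j k) = 0 := by
        intro k
        induction k using Fin.lastCases with
        | last => simp [hcd]
        | cast k => exact hrv k
      refine ⟨j.insertNth (-∑ i, r i * d (j.succAbove i)) fun i => r i * c (j.succAbove i),
        fun h => hr ?_, fun k => ?_⟩
      · funext i
        have := congrFun h (j.succAbove i)
        simpa [hc] using this
      · rw [Fin.sum_univ_succAbove _ j]
        simp only [Fin.insertNth_apply_same, Fin.insertNth_apply_succAbove]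
        rw [← hall k, neg_mul, Finset.sum_mul]
        simp only [mul_sub, Finset.sum_sub_distrib, mul_assoc]
        abel

theorem strongRankCondition_of_leftOre {R : Type*} [Ring R] [NoZeroDivisors R] [Nontrivial R]
    (hR : ∀ a b : R, a ≠ 0 → b ≠ 0 → ∃ c d : R, c * a = d * b ∧ c * a ≠ 0) :
    StrongRankCondition R := by
  rw [strongRankCondition_iff_succ]
  intro n f hf
  obtain ⟨r, hr, h⟩ := exists_ne_zero_sum_mul_eq_zero hR n fun i => f (Pi.single i 1)
  refine hr (hf ?_)
  rw [map_zero, pi_eq_sum_univ' r, map_sum]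
  funext k
  simpa [Finset.sum_apply, ← Pi.single_apply] using h k

/-! ### Graded rings with homogeneous units -/

/-- A ring whose elements have coefficients indexed by a group `G` such that supports multiply and
each nonzero element with support in a singleton is a unit. This is the left-right symmetric part of
the structure of a crossed product over a skew field. -/
structure GradedDivision (F G S : Type*) [AddCommGroup F] [Group G] [Ring S] where
  /-- the coefficients of an element -/
  coeff : S ≃+ (G →₀ F)
  coeff_one (g : G) : coeff 1 g ≠ 0 → g = 1
  coeff_mul (s t : S) (g : G) :
    coeff (s * t) g ≠ 0 → ∃ h k, coeff s h ≠ 0 ∧ coeff t k ≠ 0 ∧ h * k = g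
  exists_inv (g : G) (s : S) : s ≠ 0 → (∀ h, coeff s h ≠ 0 → h = g) →
    ∃ t, (∀ h, coeff t h ≠ 0 → h = g⁻¹) ∧ s * t = 1 ∧ t * s = 1

namespace GradedDivision

variable {F G S : Type*} [AddCommGroup F] [Group G] [Ring S]

/-- The opposite ring, graded through `g ↦ g⁻¹`. -/
noncomputable def op (D : GradedDivision F G S) : GradedDivision F G Sᵐᵒᵖ where
  coeff := (MulOpposite.opAddEquiv.symm.trans D.coeff).trans
    (Finsupp.domCongr (Equiv.inv G))
  coeff_one g h := by
    have := D.coeff_one g⁻¹ (by simpa using h)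
    simpa using this
  coeff_mul s t g h := by
    obtain ⟨a, b, ha, hb, hab⟩ := D.coeff_mul t.unop s.unop g⁻¹ (by simpa using h)
    refine ⟨b⁻¹, a⁻¹, by simpa using hb, by simpa using ha, ?_⟩
    rw [← mul_inv_rev, hab, inv_inv]
  exists_inv g s hs h := by
    obtain ⟨t, ht, h1, h2⟩ := D.exists_inv g⁻¹ s.unop (by simpa using hs) fun k hk => by
      have := h k⁻¹ (by simpa using hk)
      rw [← this, inv_inv]
    refine ⟨MulOpposite.op t, fun k hk => ?_, ?_, ?_⟩
    · have := ht k⁻¹ (by simpa using hk)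
      exact inv_injective this
    · exact MulOpposite.unop_injective h2
    · exact MulOpposite.unop_injective h1

variable (D : GradedDivision F G S)

/-- The homogeneous component of degree `g`. -/
noncomputable def comp (s : S) (g : G) : S := D.coeff.symm (Finsupp.single g (D.coeff s g))

theorem coeff_comp (s : S) (g : G) : D.coeff (D.comp s g) = Finsupp.single g (D.coeff s g) := by
  simp [comp]

theorem sum_comp (s : S) : ∑ g ∈ (D.coeff s).support, D.comp s g = s := by
  apply D.coeff.injective
  rw [map_sum]
  simp only [coeff_comp]
  exact Finsupp.sum_single (D.coeff s)

theorem eq_of_coeff_comp_ne_zero {s : S} {g h : G} (hh : D.coeff (D.comp s g) h ≠ 0) : h = g := by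
  classical
  rw [coeff_comp, Finsupp.single_apply] at hh
  by_contra hne
  exact hh (if_neg fun h => hne h.symm)

theorem coeff_sum (ι : Type*) (I : Finset ι) (f : ι → S) (g : G) :
    D.coeff (∑ i ∈ I, f i) g = ∑ i ∈ I, D.coeff (f i) g := by
  rw [map_sum, Finsupp.finsetSum_apply]

theorem isUnit_comp {s : S} {g : G} (hs : D.coeff s g ≠ 0) : IsUnit (D.comp s g) := by
  obtain ⟨t, -, h1, h2⟩ := D.exists_inv g (D.comp s g)
    (fun h => hs (by simpa [coeff_comp] using congrArg (fun x => D.coeff x g) h))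
    fun h hh => D.eq_of_coeff_comp_ne_zero hh
  exact ⟨⟨_, t, h1, h2⟩, rfl⟩

/-- Since the order is only left-invariant, `k` is taken maximal in the support of `b` first, and
then `h` with `h * k` maximal. This makes `h * k` a uniquely represented product, whose coefficient
comes from a product of two homogeneous units. -/
theorem noZeroDivisors (D : GradedDivision F G S) [Nontrivial S] [LinearOrder G] [MulLeftMono G] :
    NoZeroDivisors S := by
  refine ⟨fun {a b} hab => ?_⟩
  by_contra! hne
  obtain ⟨ha, hb⟩ := hne
  have hsa : (D.coeff a).support.Nonempty := by simpa using ha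
  have hsb : (D.coeff b).support.Nonempty := by simpa using hb
  obtain ⟨k, hk, hkmax⟩ := Finset.exists_max_image _ id hsb
  obtain ⟨h, hh, hhmax⟩ := Finset.exists_max_image _ (fun g => g * k) hsa
  have huniq : ∀ h' ∈ (D.coeff a).support, ∀ k' ∈ (D.coeff b).support, h' * k' = h * k →
      h' = h ∧ k' = k := by
    intro h' hh' k' hk' heq
    have h1 : h' * k ≤ h * k := hhmax h' hh'
    rw [← heq] at h1
    have h2 : k' = k := le_antisymm (hkmax k' hk') (le_of_mul_le_mul_left' h1)
    subst h2
    exact ⟨mul_right_cancel heq, rfl⟩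
  have hzero : ∀ h' k', h' * k' ≠ h * k → D.coeff (D.comp a h' * D.comp b k') (h * k) = 0 := by
    intro h' k' hne
    by_contra hc
    obtain ⟨x, y, hx, hy, hxy⟩ := D.coeff_mul _ _ _ hc
    rw [D.eq_of_coeff_comp_ne_zero hx, D.eq_of_coeff_comp_ne_zero hy] at hxy
    exact hne hxy
  have hcoeff : D.coeff (a * b) (h * k) = D.coeff (D.comp a h * D.comp b k) (h * k) := by
    conv_lhs => rw [← D.sum_comp a, ← D.sum_comp b, Finset.sum_mul_sum]
    rw [coeff_sum, Finset.sum_eq_single h]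
    · rw [coeff_sum, Finset.sum_eq_single k]
      · intro k' hk' hne
        exact hzero _ _ fun heq => hne (huniq h hh k' hk' heq).2
      · exact fun h => absurd hk h
    · intro h' hh' hne
      rw [coeff_sum]
      refine Finset.sum_eq_zero fun k' hk' => hzero _ _ fun heq => hne (huniq h' hh' k' hk' heq).1
    · exact fun h' => absurd hh h'
  have hunit : IsUnit (D.comp a h * D.comp b k) :=
    (D.isUnit_comp (by simpa using hh)).mul (D.isUnit_comp (by simpa using hk))
  refine hunit.ne_zero (D.coeff.injective ?_)
  rw [map_zero]
  ext g
  by_contra hc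
  obtain ⟨x, y, hx, hy, hxy⟩ := D.coeff_mul _ _ _ hc
  rw [D.eq_of_coeff_comp_ne_zero hx, D.eq_of_coeff_comp_ne_zero hy] at hxy
  subst hxy
  apply hc
  rw [← hcoeff, hab]
  simp

/-! ### The left Ore condition along subgroups -/

/-- The subring of the elements with support in a subgroup `H`. -/
def subring (H : Subgroup G) : Subring S where
  carrier := {s | ∀ g, D.coeff s g ≠ 0 → g ∈ H}
  mul_mem' {a b} ha hb g hg := by
    obtain ⟨h, k, hh, hk, rfl⟩ := D.coeff_mul a b g hg
    exact H.mul_mem (ha h hh) (hb k hk)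
  one_mem' g hg := D.coeff_one g hg ▸ H.one_mem
  add_mem' {a b} ha hb g hg := by
    by_cases h : D.coeff a g = 0
    · exact hb g fun h' => hg (by simp [h, h'])
    · exact ha g h
  zero_mem' g hg := absurd (by simp) hg
  neg_mem' {a} ha g hg := ha g fun h => hg (by simp [h])

theorem mem_subring {H : Subgroup G} {s : S} :
    s ∈ D.subring H ↔ ∀ g, D.coeff s g ≠ 0 → g ∈ H := Iff.rfl

/-- The left Ore condition for the elements with support in `H`. -/
def LeftOreOn (H : Subgroup G) : Prop :=
  ∀ a ∈ D.subring H, ∀ b ∈ D.subring H, a ≠ 0 → b ≠ 0 →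
    ∃ c ∈ D.subring H, ∃ d ∈ D.subring H, c * a = d * b ∧ c * a ≠ 0

theorem leftOreOn_bot [Nontrivial S] : D.LeftOreOn ⊥ := by
  have hinv : ∀ a ∈ D.subring ⊥, a ≠ 0 → ∃ c ∈ D.subring ⊥, c * a = 1 := by
    intro a ha ha0
    obtain ⟨t, ht, -, h2⟩ := D.exists_inv 1 a ha0 fun h hh => Subgroup.mem_bot.1 (ha h hh)
    exact ⟨t, fun h hh => Subgroup.mem_bot.2 (by simpa using ht h hh), h2⟩
  intro a ha b hb ha0 hb0
  obtain ⟨c, hc, hca⟩ := hinv a ha ha0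
  obtain ⟨d, hd, hdb⟩ := hinv b hb hb0
  exact ⟨c, hc, d, hd, by rw [hca, hdb], by rw [hca]; exact one_ne_zero⟩

theorem leftOreOn_of_directed {H : Subgroup G}
    (h : ∀ X : Finset G, (X : Set G) ⊆ H →
      ∃ K : Subgroup G, K ≤ H ∧ (X : Set G) ⊆ K ∧ D.LeftOreOn K) : D.LeftOreOn H := by
  classical
  intro a ha b hb ha0 hb0
  obtain ⟨K, hKH, hX, hK⟩ := h ((D.coeff a).support ∪ (D.coeff b).support) (by
    intro g hg
    rcases Finset.mem_union.1 (Finset.mem_coe.1 hg) with hg | hg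
    · exact ha g (by simpa using hg)
    · exact hb g (by simpa using hg))
  obtain ⟨c, hc, d, hd, h1, h2⟩ := hK a (fun g hg => hX (by simp [hg])) b
    (fun g hg => hX (by simp [hg])) ha0 hb0
  exact ⟨c, fun g hg => hKH (hc g hg), d, fun g hg => hKH (hd g hg), h1, h2⟩

open scoped Pointwise in
/-- The left Ore condition passes from the kernel of a homomorphism of `H` onto a commutative group
to `H`. -/
theorem leftOreOn_of_comm_quotient [NoZeroDivisors S] [Nontrivial S] {K H : Subgroup G}
    (hKH : K ≤ H) {Q : Type*} [CommGroup Q] (π : H →* Q) (hπ : Function.Surjective π)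
    (hker : ∀ g : H, π g = 1 ↔ (g : G) ∈ K) (hK : D.LeftOreOn K) : D.LeftOreOn H := by
  classical
  intro a ha b hb ha0 hb0
  have : StrongRankCondition (D.subring K) := by
    refine strongRankCondition_of_leftOre fun x y hx hy => ?_
    obtain ⟨c, hc, d, hd, h1, h2⟩ := hK x x.2 y y.2 (by simpa using hx) (by simpa using hy)
    exact ⟨⟨c, hc⟩, ⟨d, hd⟩, Subtype.ext h1, fun h => h2 (congrArg Subtype.val h)⟩
  -- `F` is only an additive group here, so any nonzero coefficient serves to build the units `e q`.
  obtain ⟨f, hf⟩ : ∃ f : F, f ≠ 0 := by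
    by_contra! h
    refine ha0 (D.coeff.injective ?_)
    ext g
    rw [h (D.coeff a g)]
    simp
  choose σ hσ using hπ
  let e : Q → S := fun q => D.coeff.symm (Finsupp.single (σ q : G) f)
  have he : ∀ q g, D.coeff (e q) g ≠ 0 → g = σ q := by
    intro q g hg
    by_contra hne
    refine hg ?_
    simp [e, Ne.symm hne]
  have he0 : ∀ q, e q ≠ 0 := by
    intro q h
    have := congrArg (fun x => D.coeff x (σ q : G)) h
    simp [e, hf] at this
  have heH : ∀ q, e q ∈ D.subring H := fun q g hg => by
    rw [he q g hg]
    exact (σ q).2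
  choose e' he' hee' he'e using fun q => D.exists_inv _ (e q) (he0 q) (he q)
  -- the degree in `Q` of an element of `S_K e_q` is `q`
  have hdeg : ∀ (r : D.subring K) (q : Q) (g : G), D.coeff ((r : S) * e q) g ≠ 0 →
      ∃ hg : g ∈ H, π ⟨g, hg⟩ = q := by
    intro r q g hg
    obtain ⟨h, k, hh, hk, rfl⟩ := D.coeff_mul _ _ _ hg
    have hhK := r.2 h hh
    rw [he q k hk]
    refine ⟨H.mul_mem (hKH hhK) (σ q).2, ?_⟩
    have : (⟨h * σ q, H.mul_mem (hKH hhK) (σ q).2⟩ : H) = ⟨h, hKH hhK⟩ * σ q := rfl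
    rw [this, map_mul, (hker _).2 hhK, one_mul, hσ]
  have hspan : ∀ (s : S) (W : Finset Q), (∀ g, D.coeff s g ≠ 0 → ∃ hg : g ∈ H, π ⟨g, hg⟩ ∈ W) →
      s ∈ Submodule.span (D.subring K) ((W.image e : Finset S) : Set S) := by
    intro s W hs
    rw [← D.sum_comp s]
    refine Submodule.sum_mem _ fun g hg => ?_
    obtain ⟨hgH, hgW⟩ := hs g (by simpa using hg)
    set q := π ⟨g, hgH⟩ with hq
    -- This element has degree `g * (σ q)⁻¹`, which lies in the kernel `K`.
    have hmem : D.comp s g * e' q ∈ D.subring K := by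
      intro x hx
      obtain ⟨h, k, hh, hk, rfl⟩ := D.coeff_mul _ _ _ hx
      rw [D.eq_of_coeff_comp_ne_zero hh, he' q k hk]
      have := (hker (⟨g, hgH⟩ * (σ q)⁻¹)).1 (by rw [map_mul, map_inv, hσ, ← hq, mul_inv_cancel])
      simpa using this
    have h1 : D.comp s g = (⟨_, hmem⟩ : D.subring K) • e q := by
      change _ = D.comp s g * e' q * e q
      rw [mul_assoc, he'e, mul_one]
    rw [h1]
    exact Submodule.smul_mem _ _ (Submodule.subset_span (by
      exact_mod_cast Finset.mem_image_of_mem e hgW))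
  have hindep : ∀ (U : Finset Q) (r : U → D.subring K), ∑ q, (r q : S) * e q = 0 → r = 0 := by
    intro U r hr
    funext q
    have h1 : (r q : S) * e q = 0 := by
      apply D.coeff.injective
      rw [map_zero]
      ext g
      by_contra hg
      obtain ⟨hgH, hgq⟩ := hdeg _ _ _ hg
      apply hg
      have h2 := congrArg (fun x => D.coeff x g) hr
      simp only [coeff_sum] at h2
      rw [Finset.sum_eq_single q] at h2
      · simpa using h2
      · intro q' _ hne
        by_contra hg'
        obtain ⟨_, hgq'⟩ := hdeg _ _ _ hg'
        exact hne (Subtype.ext (hgq'.symm.trans hgq))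
      · simp
    exact Subtype.ext ((mul_eq_zero.1 h1).resolve_right (he0 q))
  let T : Finset Q := (((D.coeff a).support ∪ (D.coeff b).support).subtype (· ∈ H)).image π
  have hT : ∀ x ∈ D.subring H, (D.coeff x).support ⊆ (D.coeff a).support ∪ (D.coeff b).support →
      ∀ (U : Finset Q) (u : U), ∀ g, D.coeff (e u * x) g ≠ 0 →
        ∃ hg : g ∈ H, π ⟨g, hg⟩ ∈ U * T := by
    intro x hx hsub U u g hg
    obtain ⟨h, k, hh, hk, rfl⟩ := D.coeff_mul _ _ _ hg
    have hkH := hx k hk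
    rw [he _ h hh]
    refine ⟨H.mul_mem (σ u).2 hkH, ?_⟩
    have : (⟨σ u * k, H.mul_mem (σ u).2 hkH⟩ : H) = σ u * ⟨k, hkH⟩ := rfl
    rw [this, map_mul, hσ]
    refine Finset.mul_mem_mul u.2 (Finset.mem_image_of_mem π ?_)
    rw [Finset.mem_subtype]
    exact hsub (by simpa using hk)
  obtain ⟨U, hU⟩ := exists_card_mul_lt_two_mul_card T
  let v : U ⊕ U → S := Sum.elim (fun u => e u * a) (fun u => e u * b)
  have hdep : ¬ LinearIndependent (D.subring K) v := by
    intro hli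
    have h1 := linearIndependent_le_span_aux' v hli (((U * T).image e : Finset S) : Set S) (by
      rintro _ ⟨u | u, rfl⟩
      · exact hspan _ _ (hT a ha Finset.subset_union_left U u)
      · exact hspan _ _ (hT b hb Finset.subset_union_right U u))
    have h2 : ((U * T).image e).card ≤ (U * T).card := Finset.card_image_le
    simp only [Fintype.card_sum, Fintype.card_coe, Finset.coe_sort_coe] at h1
    omega
  rw [Fintype.not_linearIndependent_iff] at hdep
  obtain ⟨r, hr, i, hi⟩ := hdep
  have hr' : (∑ u, (r (Sum.inl u) : S) * e u) * a = (-∑ u, (r (Sum.inr u) : S) * e u) * b := by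
    rw [neg_mul, ← add_eq_zero_iff_eq_neg, Finset.sum_mul, Finset.sum_mul, ← hr,
      Fintype.sum_sum_type]
    simp only [v, Sum.elim_inl, Sum.elim_inr, mul_assoc]
    rfl
  have hmemH : ∀ r : U → D.subring K, ∑ u, (r u : S) * e u ∈ D.subring H := fun r =>
    sum_mem fun u _ => mul_mem (fun g hg => hKH ((r u).2 g hg)) (heH u)
  -- If the common multiple were `0`, both factors would vanish, and independence of the `e q` would
  -- make the relation trivial.
  refine ⟨_, hmemH _, _, neg_mem (hmemH _), hr', fun h0 => hi ?_⟩
  have h1 := hindep U (fun u => r (Sum.inl u)) ((mul_eq_zero.1 h0).resolve_right ha0)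
  rw [hr'] at h0
  have h2 := hindep U (fun u => r (Sum.inr u))
    (neg_eq_zero.1 ((mul_eq_zero.1 h0).resolve_right hb0))
  rcases i with i | i
  · exact congrFun h1 i
  · exact congrFun h2 i

end GradedDivision

/-! ### Induction over the convex subgroups -/

section Convex

/-- A convex subgroup either covers another one, or is trivial, or is the directed union of the
convex subgroups that it properly contains. -/
theorem ConvexSubgroup.covBy_or_directed {G : Type*} [Group G] [LinearOrder G]
    (htot : ∀ C D : ConvexSubgroup G, C ≤ D ∨ D ≤ C)
    (C : ConvexSubgroup G) : (∃ C', C' ⋖ C) ∨ C.1 = ⊥ ∨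
      ∀ X : Finset G, (X : Set G) ⊆ C.1 → ∃ C' < C, (X : Set G) ⊆ C'.1 := by
  classical
  by_cases hbot : C.1 = ⊥
  · exact Or.inr (Or.inl hbot)
  let B : ConvexSubgroup G := ⟨⊥, by
    rw [Subgroup.coe_bot]
    exact Set.ordConnected_singleton⟩
  have hB : B < C := lt_of_le_of_ne (show (⊥ : Subgroup G) ≤ C.1 from bot_le)
    fun h => hbot (congrArg Subtype.val h).symm
  have hfin : ∀ X : Finset G, (∀ g ∈ X, ∃ C' < C, g ∈ C'.1) → ∃ C' < C, (X : Set G) ⊆ C'.1 := by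
    intro X
    induction X using Finset.induction_on with
    | empty => exact fun _ => ⟨B, hB, by simp⟩
    | insert g X _ ih =>
      intro h
      obtain ⟨C₁, h1, h1'⟩ := h g (Finset.mem_insert_self g X)
      obtain ⟨C₂, h2, h2'⟩ := ih fun x hx => h x (Finset.mem_insert_of_mem hx)
      rw [Finset.coe_insert]
      rcases htot C₁ C₂ with h12 | h12
      · exact ⟨C₂, h2, Set.insert_subset (h12 h1') h2'⟩
      · exact ⟨C₁, h1, Set.insert_subset h1' fun x hx => h12 (h2' hx)⟩
  by_cases hcov : ∀ g ∈ C.1, ∃ C' < C, g ∈ C'.1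
  · exact Or.inr (Or.inr fun X hX => hfin X fun g hg => hcov g (hX hg))
  push Not at hcov
  obtain ⟨g, hgC, hg⟩ := hcov
  have hpair : ∀ x y, (∃ C' < C, x ∈ C'.1) → (∃ C' < C, y ∈ C'.1) →
      ∃ C' < C, x ∈ C'.1 ∧ y ∈ C'.1 := by
    intro x y hx hy
    obtain ⟨C', h1, h2⟩ := hfin {x, y} fun g hg => by
      rcases Finset.mem_insert.1 hg with rfl | hg
      · exact hx
      · exact Finset.mem_singleton.1 hg ▸ hy
    exact ⟨C', h1, h2 (by simp), h2 (by simp)⟩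
  -- The union of all convex subgroups properly inside `C`; it misses `g`, so `C` covers it.
  let V : Subgroup G :=
    { carrier := {x | ∃ C' < C, x ∈ C'.1}
      mul_mem' := fun {x y} hx hy => by
        obtain ⟨C', h1, h2, h3⟩ := hpair x y hx hy
        exact ⟨C', h1, C'.1.mul_mem h2 h3⟩
      one_mem' := ⟨B, hB, one_mem _⟩
      inv_mem' := fun {x} ⟨C', h1, h2⟩ => ⟨C', h1, C'.1.inv_mem h2⟩ }
  let U : ConvexSubgroup G := ⟨V, ⟨fun x hx y hy z hz => by
    obtain ⟨C', h1, h2, h3⟩ := hpair x y hx hy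
    exact ⟨C', h1, C'.2.out h2 h3 hz⟩⟩⟩
  have hUle : U ≤ C := by
    rintro x ⟨C', h1, h2⟩
    exact h1.le h2
  refine Or.inl ⟨U, lt_of_le_of_ne hUle ?_, ?_⟩
  · intro hUC
    have hgU : g ∈ U.1 := by rwa [hUC]
    obtain ⟨C', h1, h2⟩ := hgU
    exact hg C' h1 h2
  · intro C' h1 h2
    exact h1.not_ge fun x hx => ⟨C', h2, hx⟩

variable {G : Type*} [Group G] [LinearOrder G] [MulLeftMono G]

theorem GradedDivision.leftOreOn_convex {F S : Type*} [AddCommGroup F] [Ring S] [Nontrivial S]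
    (D : GradedDivision F G S) (hConrad : IsConradian G)
    (hwo : IsWellOrder (ConvexSubgroup G) (· < ·)) (C : ConvexSubgroup G) : D.LeftOreOn C.1 := by
  have := D.noZeroDivisors
  have htot : ∀ C D : ConvexSubgroup G, C ≤ D ∨ D ≤ C := by
    intro C D
    rcases trichotomous_of (· < ·) C D with h | h | h
    · exact Or.inl h.le
    · exact Or.inl h.le
    · exact Or.inr h.le
  induction C using hwo.wf.induction with
  | h C ih =>
  rcases ConvexSubgroup.covBy_or_directed htot C with ⟨C', hC'⟩ | hbot | hdir
  · obtain ⟨hn, harch⟩ := hConrad C' C hC'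
    have hconv : ((C'.1.subgroupOf C.1 : Subgroup C.1) : Set C.1).OrdConnected :=
      ⟨fun x hx y hy z hz => C'.2.out hx hy ⟨hz.1, hz.2⟩⟩
    have : MulLeftMono C.1 := ⟨fun c x y hxy => mul_le_mul_right (α := G) hxy c⟩
    let : CommGroup (C.1 ⧸ C'.1.subgroupOf C.1) :=
      { (inferInstance : Group (C.1 ⧸ C'.1.subgroupOf C.1)) with
        mul_comm := fun a b => quotient_commute_of_isArchimedeanOrder _ hconv harch a b }
    exact D.leftOreOn_of_comm_quotient hC'.le (QuotientGroup.mk' (C'.1.subgroupOf C.1))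
      (QuotientGroup.mk'_surjective _)
      (fun g => (QuotientGroup.eq_one_iff g).trans Subgroup.mem_subgroupOf) (ih C' hC'.lt)
  · rw [hbot]
    exact D.leftOreOn_bot
  · refine D.leftOreOn_of_directed fun X hX => ?_
    obtain ⟨C', h1, h2⟩ := hdir X hX
    exact ⟨C'.1, h1.le, h2, ih C' h1⟩

theorem GradedDivision.exists_mul_eq_mul {F S : Type*} [AddCommGroup F] [Ring S] [Nontrivial S]
    (D : GradedDivision F G S) (hConrad : IsConradian G)
    (hwo : IsWellOrder (ConvexSubgroup G) (· < ·)) (a b : S) (ha : a ≠ 0) (hb : b ≠ 0) :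
    ∃ c d : S, c * a = d * b ∧ c * a ≠ 0 := by
  obtain ⟨c, -, d, -, h⟩ := D.leftOreOn_convex hConrad hwo
    ⟨⊤, by rw [Subgroup.coe_top]; exact Set.ordConnected_univ⟩ a (fun _ _ => Subgroup.mem_top _)
    b (fun _ _ => Subgroup.mem_top _) ha hb
  exact ⟨c, d, h⟩

end Convex

/-! ### Crossed products are graded with homogeneous units -/

namespace CrossedProduct

variable {F G S : Type*} [DivisionRing F] [Group G] [Ring S] [Module F S]
  (R : CrossedProduct F G S)

theorem smul_x_mul_smul_x (a b : F) (g h : G) :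
    (a • R.x g) * (b • R.x h) = (a * R.α g b * R.η g h) • R.x (g * h) := by
  calc (a • R.x g) * (b • R.x h)
      = ((a • R.x 1) * ((1 : F) • R.x g)) * ((b • R.x 1) * ((1 : F) • R.x h)) := by
        rw [R.coeff_mul_x, R.coeff_mul_x]
    _ = (a • R.x 1) * (((1 : F) • R.x g) * (b • R.x 1)) * ((1 : F) • R.x h) := by
        simp only [mul_assoc]
    _ = ((a • R.x 1) * (R.α g b • R.x 1)) * (((1 : F) • R.x g) * ((1 : F) • R.x h)) := by
        rw [R.x_mul_coeff, ← R.coeff_mul_x (R.α g b)]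
        simp only [mul_assoc]
    _ = _ := by
        rw [R.coeff_mul_coeff, R.x_mul_x, ← R.coeff_mul_x (R.η g h : F), ← mul_assoc,
          R.coeff_mul_coeff, R.coeff_mul_x]

theorem one_eq : (1 : S) = (1 : F) • R.x 1 := R.one_smul_x_one.symm

theorem repr_smul_x (a : F) (g : G) : R.x.repr (a • R.x g) = Finsupp.single g a := by
  simp

/-- The coefficients of a crossed product over a skew field. -/
noncomputable def gradedDivision : GradedDivision F G S where
  coeff := R.x.repr.toAddEquiv
  coeff_one g h := by
    classical
    by_contra hne
    refine h ?_
    change R.x.repr 1 g = 0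
    rw [R.one_eq, R.repr_smul_x, Finsupp.single_apply, if_neg (Ne.symm hne)]
  coeff_mul s t g hg := by
    classical
    change R.x.repr (s * t) g ≠ 0 at hg
    by_contra! hcon
    refine hg ?_
    have hs := R.x.linearCombination_repr s
    have ht := R.x.linearCombination_repr t
    rw [Finsupp.linearCombination_apply, Finsupp.sum] at hs ht
    rw [← hs, ← ht, Finset.sum_mul_sum, map_sum, Finsupp.finsetSum_apply]
    refine Finset.sum_eq_zero fun h hh => ?_
    rw [map_sum, Finsupp.finsetSum_apply]
    refine Finset.sum_eq_zero fun k hk => ?_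
    rw [R.smul_x_mul_smul_x, R.repr_smul_x, Finsupp.single_apply, if_neg]
    exact hcon h k (Finsupp.mem_support_iff.1 hh) (Finsupp.mem_support_iff.1 hk)
  exists_inv g s hs h := by
    classical
    have hsupp : ∀ k, k ≠ g → R.x.repr s k = 0 := fun k hk => by
      by_contra hc
      exact hk (h k hc)
    have hsg : s = R.x.repr s g • R.x g := by
      apply R.x.repr.injective
      rw [R.repr_smul_x]
      ext k
      by_cases hk : k = g
      · simp [hk]
      · rw [hsupp k hk, Finsupp.single_apply, if_neg (Ne.symm hk)]
    have ha : R.x.repr s g ≠ 0 := fun h0 => hs (by rw [hsg, h0, zero_smul])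
    set a := R.x.repr s g
    -- `b` and `c` solve the equations for a left and a right inverse separately; the two inverses
    -- then agree.
    let b : F := (R.α g⁻¹ a * R.η g⁻¹ g)⁻¹
    let c : F := (R.α g).symm (a⁻¹ * (R.η g g⁻¹ : F)⁻¹)
    have hb : (b • R.x g⁻¹) * s = 1 := by
      rw [hsg, R.smul_x_mul_smul_x, R.one_eq, inv_mul_cancel, mul_assoc,
        inv_mul_cancel₀]
      exact mul_ne_zero (by simpa using ha) (Units.ne_zero _)
    have hc : s * (c • R.x g⁻¹) = 1 := by
      rw [hsg, R.smul_x_mul_smul_x, R.one_eq, mul_inv_cancel, RingEquiv.apply_symm_apply,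
        mul_inv_cancel_left₀ ha, inv_mul_cancel₀ (Units.ne_zero _)]
    refine ⟨c • R.x g⁻¹, fun k hk => ?_, hc, ?_⟩
    · by_contra hne
      refine hk ?_
      change R.x.repr _ k = 0
      rw [R.repr_smul_x, Finsupp.single_apply, if_neg (Ne.symm hne)]
    · rw [← left_inv_eq_right_inv hb hc, hb]

end CrossedProduct

end ConradOre

theorem mainTheorem10 {F G S : Type*} [DivisionRing F] [Group G] [Ring S] [Module F S]
    (R : ConradOre.CrossedProduct F G S)
    [LinearOrder G] [MulLeftMono G] (hConrad : ConradOre.IsConradian G)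
    (hwo : IsWellOrder (ConradOre.ConvexSubgroup G) (· < ·)) :
    ConradOre.IsOreDomain S := by
  have : Nontrivial S := ⟨R.x 1, 0, R.x.ne_zero 1⟩
  have := R.gradedDivision.noZeroDivisors
  refine ⟨NoZeroDivisors.to_isDomain S, R.gradedDivision.exists_mul_eq_mul hConrad hwo,
    fun a b ha hb => ?_⟩
  -- The grading by `g ↦ g⁻¹` keeps the same ordered group, so the hypotheses apply unchanged to the
  -- opposite ring.
  obtain ⟨c, d, h1, h2⟩ := R.gradedDivision.op.exists_mul_eq_mul hConrad hwo (MulOpposite.op a)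
    (MulOpposite.op b) (by simpa using ha) (by simpa using hb)
  exact ⟨c.unop, d.unop, congrArg MulOpposite.unop h1,
    fun h => h2 (MulOpposite.unop_injective h)⟩
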